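/- Let $X$ be a compact topological space and $T:X\to X$ a homeomorphism. For $x\in X$ put $O^+(x)=\{T^k(x):k\ge 0\}$. A point $y\in X$ is called minimal if $\overline{O^+(x)}=\overline{O^+(y)}$ for every $x\in\overline{O^+(y)}$ (that is, the subsystem $(\overline{O^+(y)},T)$ is minimal); let $\mathrm M(X,T)$ be the set of minimal points. A point $x\in X$ is called wandering if it has a neighborhood $U$ such that $T^k(U)\cap U=\emptyset$ for all integers $k\ge 1$; let $\Omega(X,T)$ be the set of all points that are not wandering. Suppose that $\overline{\mathrm M(X,T)}=\Omega(X,T)$, and let $\Phi$ be a countable set of continuous functions $X\to\mathbb R$. Then there exists a set $\Xi\subset\Omega(X,T)$, invariant in the sense that $T(\Xi)=\Xi$ and dense in $\Omega(X,T)$, such that for every $\varphi\in\Phi$ and every $x\in\Xi$ the limit $$\lim_{n\to\infty}\frac1n\sum_{k=0}^{n-1}\varphi(T^k(x))$$ exists in $\mathbb R$. -/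

import Mathlib

open Set Filter Topology

/-- The positive semiorbit `O⁺(x) = {Tᵏ x : k ≥ 0}`. -/
def forwardOrbit {X : Type*} (T : X → X) (x : X) : Set X :=
  {z | ∃ k : ℕ, T^[k] x = z}

/-- The subsystem of `T` on a closed set `Y` is minimal: the positive semiorbit of every point of
`Y` has closure `Y`. (As `Y` is closed, the closure in `X` and the closure in the subspace `Y` of a
subset of `Y` agree.) -/
def IsMinimalOn {X : Type*} [TopologicalSpace X] (T : X → X) (Y : Set X) : Prop :=
  ∀ x ∈ Y, closure (forwardOrbit T x) = Y

/-- `M(X,T)`: the minimal (almost periodic) points, i.e. those `y` for which the subsystem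
on the closure of `O⁺(y)` is minimal. -/
def minimalPoints {X : Type*} [TopologicalSpace X] (T : X → X) : Set X :=
  {y | IsMinimalOn T (closure (forwardOrbit T y))}

/-- A point is wandering if some neighborhood `U` of it satisfies `Tᵏ(U) ∩ U = ∅` for all
integers `k ≥ 1`. -/
def IsWanderingPoint {X : Type*} [TopologicalSpace X] (T : X → X) (x : X) : Prop :=
  ∃ U ∈ 𝓝 x, ∀ k : ℕ, 1 ≤ k → (T^[k] '' U) ∩ U = ∅

/-- `Ω(X,T)`: the non-wandering set. -/
def nonwanderingSet {X : Type*} [TopologicalSpace X] (T : X → X) : Set X :=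
  {x | ¬ IsWanderingPoint T x}

/-!
The set `Ξ` consists of the minimal points at which the averages of all functions in `Φ` converge.
It is invariant, and since the orbit of any of its points is dense in the corresponding minimal set,
it is dense in the closure of the minimal points as soon as it meets every minimal set. So the heart
of the matter is that a continuous self-map `f` of a nonempty compact space `K` has a point with
convergent averages for countably many given functions
(`exists_forall_tendsto_birkhoffAverage`). No ergodic theorem, and no separation or metrizability of
`K`, is used.

Let `P ψ` be the maximal ergodic average of `ψ ∈ C(K, ℝ)`, the best uniform linear growth rate of
its Birkhoff sums (`maxErgodicAverage`). By compactness some point `x` satisfies `S_n ψ (x) ≥ n P ψ`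
for all `n` (`exists_forall_mul_maxErgodicAverage_le`). Comparing `S_n (ψ ± t φ)` with `S_n ψ` at
this point traps the limit points of the averages of `φ` between `(P ψ - P (ψ - t φ)) / t` and
`(P (ψ + t φ) - P ψ) / t` (`eventually_birkhoffAverage_lt`). Hence these averages converge whenever
`P` is differentiable at `ψ` in the direction `φ`, or merely has relatively small symmetric second
differences there. As `P` is 1-Lipschitz, for each `φ` and `ε` this smallness holds on an open dense
set of `ψ` (`isOpen_almostSmoothSet`, `dense_almostSmoothSet`), and the Baire category theorem in
`C(K, ℝ)` provides one `ψ`, and thus one point `x`, that serves for all of `Φ`.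
-/

/-! ### Preliminaries on real sequences and functions -/

theorem exists_tendsto_of_eventually_mem_Ioo {a : ℕ → ℝ}
    (h : ∀ ε > 0, ∃ l u : ℝ, u - l < ε ∧ ∀ᶠ n in atTop, l < a n ∧ a n < u) :
    ∃ b, Tendsto a atTop (𝓝 b) := by
  refine cauchySeq_tendsto_of_complete (Metric.cauchySeq_iff'.2 fun ε hε => ?_)
  obtain ⟨l, u, hlu, hev⟩ := h ε hε
  obtain ⟨N, hN⟩ := eventually_atTop.1 hev
  refine ⟨N, fun n hn => ?_⟩
  have h1 := hN n hn
  have h2 := hN N le_rfl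
  rw [Real.dist_eq, abs_lt]
  constructor <;> linarith

theorem exists_second_difference_lt {g : ℝ → ℝ} {s : ℝ} (hg : DifferentiableAt ℝ g s)
    {ε : ℝ} (hε : 0 < ε) : ∃ t > 0, g (s + t) + g (s - t) - 2 * g s < ε * t := by
  have hd : HasDerivAt g (deriv g s) s := hg.hasDerivAt
  have h1 : HasDerivAt (fun t => g (s + t)) (deriv g s) 0 :=
    HasDerivAt.comp_const_add s 0 (by simpa using hd)
  have h2 : HasDerivAt (fun t => g (s - t)) (-deriv g s) 0 :=
    HasDerivAt.comp_const_sub s 0 (by simpa using hd)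
  have h3 := (h1.add h2).isLittleO.def (half_pos hε)
  have h4 := (h3.filter_mono (nhdsWithin_le_nhds (s := Ioi 0))).and self_mem_nhdsWithin
  obtain ⟨t, ht, ht0⟩ := h4.exists
  have ht0 : 0 < t := ht0
  refine ⟨t, ht0, ?_⟩
  simp only [Pi.add_apply, add_zero, sub_zero, add_neg_cancel, smul_zero, Real.norm_eq_abs,
    abs_of_pos ht0] at ht
  nlinarith [le_abs_self (g (s + t) + g (s - t) - (g s + g s)), mul_pos hε ht0]

/-! ### The maximal ergodic average -/

section Compact

variable {K : Type*} [TopologicalSpace K]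

theorem continuous_birkhoffSum {f : K → K} (hf : Continuous f) (ψ : C(K, ℝ)) (n : ℕ) :
    Continuous (birkhoffSum f ψ n) := by
  unfold birkhoffSum
  exact continuous_finsetSum _ fun k _ => ψ.continuous.comp (hf.iterate k)

/-- The real numbers `c` such that the Birkhoff sums of `ψ` grow at most like `n * c`, up to a
bounded error which is uniform in the point. -/
def growthBounds (f : K → K) (ψ : C(K, ℝ)) : Set ℝ :=
  {c | ∃ C : ℝ, ∀ (n : ℕ) (x : K), birkhoffSum f ψ n x ≤ n * c + C}

/-- The maximal ergodic average of `ψ`: the optimal uniform linear growth rate of its Birkhoff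
sums. For `K` nonempty compact metrizable and `f` continuous it is the maximum of `∫ ψ ∂μ` over the
`f`-invariant Borel probability measures `μ`. -/
noncomputable def maxErgodicAverage (f : K → K) (ψ : C(K, ℝ)) : ℝ :=
  sInf (growthBounds f ψ)

variable [CompactSpace K]

theorem birkhoffSum_le_norm (f : K → K) (ψ : C(K, ℝ)) (n : ℕ) (x : K) :
    birkhoffSum f ψ n x ≤ n * ‖ψ‖ := by
  calc birkhoffSum f ψ n x ≤ ∑ _k ∈ Finset.range n, ‖ψ‖ :=
        Finset.sum_le_sum fun k _ => ψ.apply_le_norm _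
    _ = n * ‖ψ‖ := by simp

theorem neg_norm_le_birkhoffSum (f : K → K) (ψ : C(K, ℝ)) (n : ℕ) (x : K) :
    -(n * ‖ψ‖) ≤ birkhoffSum f ψ n x := by
  calc -(n * ‖ψ‖) = ∑ _k ∈ Finset.range n, -‖ψ‖ := by simp
    _ ≤ birkhoffSum f ψ n x := Finset.sum_le_sum fun k _ => ψ.neg_norm_le_apply _

/-- If every orbit can be cut into pieces of bounded length along which the average of `ψ` is at
most `c`, then `c` bounds the growth of the Birkhoff sums. -/
theorem mem_growthBounds_of_forall_exists {f : K → K} {ψ : C(K, ℝ)} {c : ℝ} {N : ℕ}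
    (h : ∀ x, ∃ k, 1 ≤ k ∧ k ≤ N ∧ birkhoffSum f ψ k x ≤ k * c) : c ∈ growthBounds f ψ := by
  refine ⟨N * (‖ψ‖ + |c|), fun n => ?_⟩
  induction n using Nat.strong_induction_on with
  | _ n ih =>
    intro x
    rcases lt_or_ge n N with hn | hn
    · have h1 := birkhoffSum_le_norm f ψ n x
      have h2 : (n : ℝ) * (‖ψ‖ + |c|) ≤ N * (‖ψ‖ + |c|) := by gcongr
      have h3 : (n : ℝ) * (-|c|) ≤ n * c := by gcongr; exact neg_abs_le c
      linarith
    · obtain ⟨k, hk1, hkN, hk⟩ := h x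
      obtain ⟨m, rfl⟩ := Nat.exists_eq_add_of_le (hkN.trans hn)
      have := ih m (by omega) (f^[k] x)
      rw [birkhoffSum_add]
      push_cast
      linarith

theorem norm_mem_growthBounds (f : K → K) (ψ : C(K, ℝ)) : ‖ψ‖ ∈ growthBounds f ψ :=
  ⟨0, fun n x => by simpa using birkhoffSum_le_norm f ψ n x⟩

theorem eventually_birkhoffSum_lt {f : K → K} {ψ : C(K, ℝ)} {c : ℝ}
    (hc : maxErgodicAverage f ψ < c) (x : K) :
    ∀ᶠ n : ℕ in atTop, birkhoffSum f ψ n x < n * c := by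
  obtain ⟨b, ⟨C, hC⟩, hb⟩ := exists_lt_of_csInf_lt ⟨_, norm_mem_growthBounds f ψ⟩ hc
  obtain ⟨N, hN⟩ := exists_nat_gt (C / (c - b))
  filter_upwards [eventually_ge_atTop N] with n hn
  have h1 : (N : ℝ) ≤ n := by exact_mod_cast hn
  have h2 := (div_lt_iff₀ (sub_pos.2 hb)).1 (hN.trans_le h1)
  linarith [hC n x]

/-- Along an orbit that is optimal for `ψ`, the averages of `φ` are asymptotically bounded by the
difference quotients of the maximal ergodic average at `ψ` in the direction `φ`. -/
theorem eventually_birkhoffAverage_lt {f : K → K} {ψ φ : C(K, ℝ)} {x : K}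
    (hx : ∀ n : ℕ, n * maxErgodicAverage f ψ ≤ birkhoffSum f ψ n x) {t c : ℝ} (ht : 0 < t)
    (hc : maxErgodicAverage f (ψ + t • φ) - maxErgodicAverage f ψ < t * c) :
    ∀ᶠ n : ℕ in atTop, birkhoffAverage ℝ f φ n x < c := by
  filter_upwards [eventually_birkhoffSum_lt (sub_lt_iff_lt_add.1 hc) x,
    eventually_gt_atTop 0] with n hn hn0
  have h1 : birkhoffSum f (ψ + t • φ : C(K, ℝ)) n x
      = birkhoffSum f ψ n x + t * birkhoffSum f φ n x := by
    simp [birkhoffSum, Finset.sum_add_distrib, Finset.mul_sum]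
  have hn1 : (0 : ℝ) < n := by exact_mod_cast hn0
  rw [birkhoffAverage, smul_eq_mul, inv_mul_lt_iff₀ hn1]
  have h2 : t * birkhoffSum f φ n x < t * (n * c) := by
    linarith [hx n]
  exact lt_of_mul_lt_mul_left h2 ht.le

variable [Nonempty K]

theorem bddBelow_growthBounds (f : K → K) (ψ : C(K, ℝ)) : BddBelow (growthBounds f ψ) := by
  refine ⟨-‖ψ‖, ?_⟩
  rintro c ⟨C, hC⟩
  by_contra! hlt
  obtain ⟨n, hn⟩ := exists_nat_gt (C / (-‖ψ‖ - c))
  obtain ⟨x⟩ := ‹Nonempty K›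
  have h1 := (neg_norm_le_birkhoffSum f ψ n x).trans (hC n x)
  rw [div_lt_iff₀ (by linarith)] at hn
  linarith

theorem lipschitzWith_maxErgodicAverage (f : K → K) :
    LipschitzWith 1 (maxErgodicAverage f) := by
  refine LipschitzWith.of_le_add fun ψ ψ' => ?_
  rw [← sub_le_iff_le_add]
  refine le_csInf ⟨_, norm_mem_growthBounds f ψ'⟩ ?_
  rintro c ⟨C, hC⟩
  rw [sub_le_iff_le_add]
  refine csInf_le (bddBelow_growthBounds f ψ) ⟨C, fun n x => ?_⟩
  have h1 := birkhoffSum_le_norm f (ψ - ψ') n x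
  have h2 : birkhoffSum f (ψ - ψ' : C(K, ℝ)) n x
      = birkhoffSum f ψ n x - birkhoffSum f ψ' n x := by
    rw [ContinuousMap.coe_sub, birkhoffSum_sub]
  have h3 := hC n x
  rw [dist_eq_norm]
  linarith

/-- Some orbit realizes the maximal ergodic average at all times. Otherwise, by compactness, every
orbit could be cut into pieces of bounded length along which the average is smaller by a fixed
amount. -/
theorem exists_forall_mul_maxErgodicAverage_le {f : K → K} (hf : Continuous f) (ψ : C(K, ℝ)) :
    ∃ x, ∀ n : ℕ, n * maxErgodicAverage f ψ ≤ birkhoffSum f ψ n x := by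
  by_contra! hcon
  set P := maxErgodicAverage f ψ with hP
  let U : ℕ → Set K := fun m =>
    ⋃ k ∈ Finset.Icc 1 m, {x | birkhoffSum f ψ k x < k * (P - 1 / ((m : ℝ) + 1))}
  have hUo : ∀ m, IsOpen (U m) := fun m => isOpen_biUnion fun k _ =>
    isOpen_lt (continuous_birkhoffSum hf ψ k) continuous_const
  have hUmono : Monotone U := by
    intro m m' hm x hx
    simp only [U, mem_iUnion, Finset.mem_Icc, mem_ofPred_eq, exists_prop] at hx ⊢
    obtain ⟨k, hk, hx⟩ := hx
    refine ⟨k, ⟨hk.1, hk.2.trans hm⟩, hx.trans_le ?_⟩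
    gcongr
  have hcov : (univ : Set K) ⊆ ⋃ m, U m := by
    intro x _
    obtain ⟨k, hk⟩ := hcon x
    have hk0 : k ≠ 0 := by
      rintro rfl
      simp at hk
    have hk1 : (0 : ℝ) < k := by positivity
    obtain ⟨j, hj⟩ := exists_nat_one_div_lt (div_pos (sub_pos.2 hk) hk1)
    rw [lt_div_iff₀ hk1] at hj
    simp only [U, mem_iUnion, Finset.mem_Icc, mem_ofPred_eq, exists_prop]
    refine ⟨max k j, k, ⟨by omega, le_max_left _ _⟩, ?_⟩
    have h1 : 1 / (((max k j : ℕ) : ℝ) + 1) ≤ 1 / ((j : ℝ) + 1) := by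
      gcongr
      exact le_max_right _ _
    have h2 := mul_le_mul_of_nonneg_right h1 hk1.le
    linarith
  obtain ⟨m, hm⟩ := isCompact_univ.elim_directed_cover U hUo hcov hUmono.directed_le
  have hmem : P - 1 / ((m : ℝ) + 1) ∈ growthBounds f ψ := by
    refine mem_growthBounds_of_forall_exists (N := m) fun x => ?_
    have hx := hm (mem_univ x)
    simp only [U, mem_iUnion, Finset.mem_Icc, mem_ofPred_eq, exists_prop] at hx
    obtain ⟨k, hk, hx⟩ := hx
    exact ⟨k, hk.1, hk.2, hx.le⟩
  have h1 : P ≤ P - 1 / ((m : ℝ) + 1) := csInf_le (bddBelow_growthBounds f ψ) hmem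
  have h2 : (0 : ℝ) < 1 / ((m : ℝ) + 1) := by positivity
  linarith

/-! ### Generic smoothness of the maximal ergodic average -/

/-- The functions `ψ` at which the maximal ergodic average has a symmetric second difference in the
direction `φ` that is smaller than `ε` relative to its step. -/
def almostSmoothSet (f : K → K) (φ : C(K, ℝ)) (ε : ℝ) : Set C(K, ℝ) :=
  {ψ | ∃ t > 0, maxErgodicAverage f (ψ + t • φ) + maxErgodicAverage f (ψ - t • φ)
    - 2 * maxErgodicAverage f ψ < ε * t}

theorem isOpen_almostSmoothSet (f : K → K) (φ : C(K, ℝ)) (ε : ℝ) :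
    IsOpen (almostSmoothSet f φ ε) := by
  have hP : Continuous (maxErgodicAverage f) := (lipschitzWith_maxErgodicAverage f).continuous
  have : almostSmoothSet f φ ε = ⋃ t > (0 : ℝ), {ψ | maxErgodicAverage f (ψ + t • φ)
      + maxErgodicAverage f (ψ - t • φ) - 2 * maxErgodicAverage f ψ < ε * t} := by
    ext ψ
    simp [almostSmoothSet]
  rw [this]
  exact isOpen_biUnion fun t _ => isOpen_lt (by fun_prop) continuous_const

theorem dense_almostSmoothSet (f : K → K) (φ : C(K, ℝ)) {ε : ℝ} (hε : 0 < ε) :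
    Dense (almostSmoothSet f φ ε) := by
  intro ψ
  -- A Lipschitz function on the line `ψ + ℝ φ` is differentiable at almost every point.
  let L : ℝ → C(K, ℝ) := fun s => ψ + s • φ
  have hL : LipschitzWith ‖φ‖₊ L := by
    refine LipschitzWith.of_dist_le_mul fun s s' => ?_
    rw [dist_eq_norm, dist_eq_norm, add_sub_add_left_eq_sub, ← sub_smul, norm_smul, coe_nnnorm,
      mul_comm]
  have hg : Dense {s : ℝ | DifferentiableAt ℝ (maxErgodicAverage f ∘ L) s} :=
    MeasureTheory.Measure.dense_of_ae
      ((lipschitzWith_maxErgodicAverage f).comp hL).ae_differentiableAt_real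
  have hsub : ∀ s ∈ {s : ℝ | DifferentiableAt ℝ (maxErgodicAverage f ∘ L) s},
      L s ∈ almostSmoothSet f φ ε := by
    intro s hs
    obtain ⟨t, ht, h⟩ := exists_second_difference_lt hs hε
    refine ⟨t, ht, ?_⟩
    simpa only [Function.comp, L, add_smul, sub_smul, add_assoc, add_sub_assoc] using h
  have h0 : L 0 = ψ := by simp [L]
  rw [← h0]
  have himage : L '' {s : ℝ | DifferentiableAt ℝ (maxErgodicAverage f ∘ L) s}
      ⊆ almostSmoothSet f φ ε := image_subset_iff.2 hsub
  exact closure_mono himage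
    (image_closure_subset_closure_image hL.continuous (mem_image_of_mem L (hg 0)))

/-- For a continuous self-map of a nonempty compact space, some point has convergent Birkhoff
averages for all functions of a given countable family. -/
theorem exists_forall_tendsto_birkhoffAverage {f : K → K} (hf : Continuous f)
    {Φ : Set C(K, ℝ)} (hΦ : Φ.Countable) :
    ∃ x, ∀ φ ∈ Φ, ∃ l, Tendsto (birkhoffAverage ℝ f φ · x) atTop (𝓝 l) := by
  have hdense : Dense (⋂ φ ∈ Φ, ⋂ m : ℕ, almostSmoothSet f φ (1 / ((m : ℝ) + 1))) := by
    refine dense_biInter_of_Gδ (fun φ _ => IsGδ.iInter_of_isOpen fun m =>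
      isOpen_almostSmoothSet f φ _) hΦ fun φ _ => ?_
    exact dense_iInter_of_isOpen (fun m => isOpen_almostSmoothSet f φ _)
      fun m => dense_almostSmoothSet f φ (by positivity)
  obtain ⟨ψ, hψ⟩ := hdense.nonempty
  simp only [mem_iInter] at hψ
  obtain ⟨x, hx⟩ := exists_forall_mul_maxErgodicAverage_le hf ψ
  refine ⟨x, fun φ hφ => exists_tendsto_of_eventually_mem_Ioo fun ε hε => ?_⟩
  obtain ⟨m, hm⟩ := exists_nat_one_div_lt (div_pos hε three_pos)
  obtain ⟨t, ht, hsd⟩ := hψ φ hφ m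
  set P := maxErgodicAverage f
  have hsd' : (P (ψ + t • φ) - P ψ) + (P (ψ - t • φ) - P ψ) < t * (ε / 3) := by
    have := mul_lt_mul_of_pos_right hm ht
    linarith
  refine ⟨-((P (ψ - t • φ) - P ψ) / t + ε / 3), (P (ψ + t • φ) - P ψ) / t + ε / 3, ?_, ?_⟩
  · have := (div_lt_iff₀' ht).2 hsd'
    rw [add_div] at this
    linarith
  · have hup := eventually_birkhoffAverage_lt (φ := φ) hx ht
      (c := (P (ψ + t • φ) - P ψ) / t + ε / 3) (by
        rw [mul_add, mul_div_cancel₀ _ ht.ne']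
        have := mul_pos ht hε
        linarith)
    have hlo := eventually_birkhoffAverage_lt (φ := -φ) hx ht
      (c := (P (ψ - t • φ) - P ψ) / t + ε / 3) (by
        rw [mul_add, mul_div_cancel₀ _ ht.ne', smul_neg, ← sub_eq_add_neg]
        have := mul_pos ht hε
        linarith)
    filter_upwards [hup, hlo] with n h1 h2
    rw [ContinuousMap.coe_neg, birkhoffAverage_neg, Pi.neg_apply, Pi.neg_apply] at h2
    exact ⟨by linarith, h1⟩

end Compact

/-! ### Minimal points and the invariant dense set -/

theorem mapsTo_closure_forwardOrbit {X : Type*} [TopologicalSpace X] {T : X → X}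
    (hT : Continuous T) (y : X) :
    MapsTo T (closure (forwardOrbit T y)) (closure (forwardOrbit T y)) := by
  refine MapsTo.closure ?_ hT
  rintro _ ⟨k, rfl⟩
  exact ⟨k + 1, Function.iterate_succ_apply' T k y⟩

theorem mem_closure_forwardOrbit {X : Type*} [TopologicalSpace X] (T : X → X) (y : X) :
    y ∈ closure (forwardOrbit T y) :=
  subset_closure ⟨0, rfl⟩

theorem exists_forall_tendsto_birkhoffAverage_of_isClosed {X : Type*} [TopologicalSpace X]
    [CompactSpace X] {T : X → X} (hT : Continuous T) {Y : Set X} (hY : IsClosed Y)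
    (hne : Y.Nonempty) (hTY : MapsTo T Y Y) {Φ : Set C(X, ℝ)} (hΦ : Φ.Countable) :
    ∃ x ∈ Y, ∀ φ ∈ Φ, ∃ l, Tendsto (birkhoffAverage ℝ T φ · x) atTop (𝓝 l) := by
  have : CompactSpace Y := isCompact_iff_compactSpace.1 hY.isCompact
  have : Nonempty Y := hne.to_subtype
  obtain ⟨x, hx⟩ := exists_forall_tendsto_birkhoffAverage
    (hT.restrict hTY) (hΦ.image fun φ => φ.restrict Y)
  refine ⟨x, x.2, fun φ hφ => ?_⟩
  obtain ⟨l, hl⟩ := hx _ (mem_image_of_mem _ hφ)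
  refine ⟨l, hl.congr fun n => ?_⟩
  simp only [birkhoffAverage, birkhoffSum, ContinuousMap.restrict_apply, hTY.iterate_restrict,
    MapsTo.val_restrict_apply]

theorem Homeomorph.closure_forwardOrbit_apply {X : Type*} [TopologicalSpace X] (T : X ≃ₜ X)
    (y : X) : closure (forwardOrbit T (T y)) = T '' closure (forwardOrbit T y) := by
  rw [T.image_closure]
  congr 1
  ext z
  constructor
  · rintro ⟨k, rfl⟩
    exact ⟨_, ⟨k, rfl⟩, (Function.Commute.iterate_self T k y).symm⟩
  · rintro ⟨_, ⟨k, rfl⟩, rfl⟩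
    exact ⟨k, Function.Commute.iterate_self T k y⟩

theorem Homeomorph.apply_mem_minimalPoints_iff {X : Type*} [TopologicalSpace X] (T : X ≃ₜ X)
    {y : X} : T y ∈ minimalPoints T ↔ y ∈ minimalPoints T := by
  simp only [minimalPoints, IsMinimalOn, mem_ofPred_eq, T.closure_forwardOrbit_apply,
    forall_mem_image, T.injective.image_injective.eq_iff]

/-- Convergence of Birkhoff averages of a bounded function does not depend on the initial segment
of the orbit. -/
theorem exists_tendsto_birkhoffAverage_apply_iff {X : Type*} [TopologicalSpace X] [CompactSpace X]
    (T : X → X) (φ : C(X, ℝ)) (x : X) :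
    (∃ l, Tendsto (birkhoffAverage ℝ T φ · (T x)) atTop (𝓝 l)) ↔
      ∃ l, Tendsto (birkhoffAverage ℝ T φ · x) atTop (𝓝 l) := by
  have h := tendsto_birkhoffAverage_apply_sub_birkhoffAverage' (𝕜 := ℝ)
    (g := (φ : X → ℝ)) (isCompact_range φ.continuous).isBounded T x
  constructor
  · rintro ⟨l, hl⟩
    exact ⟨l, by simpa using hl.sub h⟩
  · rintro ⟨l, hl⟩
    exact ⟨l, by simpa using hl.add h⟩

theorem corollary13p2 {X : Type*} [TopologicalSpace X] [CompactSpace X] (T : X ≃ₜ X)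
    (hT : closure (minimalPoints T) = nonwanderingSet T)
    (Φ : Set C(X, ℝ)) (hΦ : Φ.Countable) :
    ∃ Ξ : Set X, T '' Ξ = Ξ ∧ Ξ ⊆ nonwanderingSet T ∧ nonwanderingSet T ⊆ closure Ξ ∧
      ∀ φ ∈ Φ, ∀ x ∈ Ξ, ∃ l : ℝ,
        Tendsto (fun n : ℕ => (1 / (n : ℝ)) * ∑ k ∈ Finset.range n, φ (T^[k] x)) atTop (𝓝 l) := by
  let Ξ : Set X := {x | x ∈ minimalPoints T ∧
    ∀ φ ∈ Φ, ∃ l, Tendsto (birkhoffAverage ℝ T φ · x) atTop (𝓝 l)}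
  have hΞ : ∀ x, T x ∈ Ξ ↔ x ∈ Ξ := fun x => by
    simp only [Ξ, mem_ofPred_eq, T.apply_mem_minimalPoints_iff,
      exists_tendsto_birkhoffAverage_apply_iff]
  refine ⟨Ξ, ?_, fun x hx => hT ▸ subset_closure hx.1, ?_, fun φ hφ x hx => ?_⟩
  · have hpre : T ⁻¹' Ξ = Ξ := ext hΞ
    calc T '' Ξ = T '' (T ⁻¹' Ξ) := by rw [hpre]
      _ = Ξ := image_preimage_eq Ξ T.surjective
  · rw [← hT]
    refine closure_minimal (fun y hy => ?_) isClosed_closure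
    obtain ⟨x, hxY, hx⟩ := exists_forall_tendsto_birkhoffAverage_of_isClosed T.continuous
      isClosed_closure ⟨y, mem_closure_forwardOrbit T y⟩
      (mapsTo_closure_forwardOrbit T.continuous y) hΦ
    have hxy : closure (forwardOrbit T x) = closure (forwardOrbit T y) := hy x hxY
    have hxΞ : x ∈ Ξ := ⟨by rwa [minimalPoints, mem_ofPred_eq, hxy], hx⟩
    -- The orbit of `x` lies in `Ξ` and accumulates at `y`.
    have horb : forwardOrbit T x ⊆ Ξ := by
      rintro _ ⟨k, rfl⟩
      exact MapsTo.iterate (fun z hz => (hΞ z).2 hz) k hxΞ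
    exact closure_mono horb (hxy ▸ mem_closure_forwardOrbit T y)
  · obtain ⟨l, hl⟩ := hx.2 φ hφ
    refine ⟨l, hl.congr fun n => ?_⟩
    simp [birkhoffAverage, birkhoffSum]
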